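/- Let $m,n\in\mathbb N=\{1,2,\dots\}$. On $\mathbb R^n$ write $f^\wedge(y)=(2\pi)^{-n/2}\int_{\mathbb R^n}e^{-i\,y\cdot x}f(x)\,d^nx$ and $g^\vee(x)=(2\pi)^{-n/2}\int_{\mathbb R^n}e^{i\,x\cdot y}g(y)\,d^ny$. Let $C_0^\infty(\mathbb R^n)$ be the smooth compactly supported functions $\mathbb R^n\to\mathbb C$ and $C_\infty(\mathbb R^n)$ the continuous functions $\mathbb R^n\to\mathbb C$ tending to $0$ at infinity. For $p\in[1,\infty)$ equip the space $L^p(\mathbb R^n)^m$ of $m$-tuples of complex-valued $L^p$ functions with the norm $\|f\|=\sum_{j=1}^m\|f_j\|_{L^p(\mathbb R^n)}$, and let $L^p(\mathbb R^n)^m_+$ be the set of $f\in L^p(\mathbb R^n)^m$ with $f_j\ge 0$ a.e. for $1\le j\le m$. A function $\phi:\mathbb R^n\to\mathbb C$ is called conditionally positive semidefinite if for all $N\in\mathbb N$ and $x_1,\dots,x_N\in\mathbb R^n$ the matrix $A=(\phi(x_r-x_s))_{1\le r,s\le N}$ is self-adjoint and satisfies $\sum_{r,s=1}^N\overline{c_r}A_{r,s}c_s\ge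 0$ for all $c\in\mathbb C^N$ with $\sum_{r=1}^N c_r=0$. Let $F:\mathbb R^n\to\mathbb C^{m\times m}$ be continuous with $F(x)$ diagonal for all $x\in\mathbb R^n$, and suppose there is $c\in\mathbb R$ such that $\operatorname{Re}F_{j,j}(x)\le c$ for all $x\in\mathbb R^n$ and $1\le j\le m$. Then for every $t>0$ $$C_0^\infty(\mathbb R^n)^m\to C_\infty(\mathbb R^n)^m,\qquad (f_1,\dots,f_m)^\top\mapsto\Big(\exp(tF)\,(f_1^\wedge,\dots,f_m^\wedge)^\top\Big)^\vee\qquad(*)$$ is a well-defined linear operator, and the following items are equivalent: (i) For all $1\le j\le m$, $F_{j,j}$ is conditionally positive semidefinite. (ii) For all $t>0$, the operator $(*)$ extends to a bounded linear operator $(\exp(tF))(-i\nabla)$ on $L^1(\mathbb R^n)^m$ satisfying $(\exp(tF))(-i\nabla)\big(L^1(\mathbb R^n)^m_+\big)\subseteq L^1(\mathbb R^n)^m_+$. (iii) There exists $p\in(1,\infty)$ such that for all $t>0$, the operator $(*)$ extends to a bounded linear operator $(\exp(tF))(-i\nabla)$ on $L^p(\mathbb R^n)^m$ satisfying $(\exp(tF))(-i\nabla)\big(L^p(\mathbb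 R^n)^m_+\big)\subseteq L^p(\mathbb R^n)^m_+$. (iv) For all $p\in(1,\infty)$ and all $t>0$, the operator $(*)$ extends to a bounded linear operator $(\exp(tF))(-i\nabla)$ on $L^p(\mathbb R^n)^m$ satisfying $(\exp(tF))(-i\nabla)\big(L^p(\mathbb R^n)^m_+\big)\subseteq L^p(\mathbb R^n)^m_+$. -/

import Mathlib

open MeasureTheory Filter Topology
open scoped ENNReal Distributions ZeroAtInfty ComplexOrder Matrix

noncomputable section

namespace PosPres

/-- Euclidean space `ℝⁿ`. -/
abbrev Rn (n : ℕ) : Type := EuclideanSpace ℝ (Fin n)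

/-- `C₀^∞(ℝⁿ)`: smooth compactly supported complex-valued functions on `ℝⁿ`. -/
abbrev CcInf (n : ℕ) : Type := 𝓓((⊤ : TopologicalSpace.Opens (Rn n)), ℂ)

/-- `f^∧(y) = (2π)^(-n/2) ∫ e^{-i y·x} f(x) dx`. -/
def hat {n : ℕ} (f : Rn n → ℂ) (y : Rn n) : ℂ :=
  ((2 * Real.pi) ^ (-(n : ℝ) / 2) : ℝ) *
    ∫ x : Rn n, Complex.exp (-Complex.I * (inner ℝ y x : ℝ)) * f x

/-- `g^∨(x) = (2π)^(-n/2) ∫ e^{i x·y} g(y) dy`. -/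
def check {n : ℕ} (g : Rn n → ℂ) (x : Rn n) : ℂ :=
  ((2 * Real.pi) ^ (-(n : ℝ) / 2) : ℝ) *
    ∫ y : Rn n, Complex.exp (Complex.I * (inner ℝ x y : ℝ)) * g y

/-- The action of `G(-i∇)` on test functions:
`(f₁,…,f_m)ᵀ ↦ (G (f₁^∧,…,f_m^∧)ᵀ)^∨`. -/
def multiplier {m n : ℕ} (G : Rn n → Matrix (Fin m) (Fin m) ℂ)
    (f : Fin m → CcInf n) (j : Fin m) : Rn n → ℂ :=
  check fun y => (G y *ᵥ fun k => hat (f k) y) j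

/-- `L^p(ℝⁿ)^m`, normed by `‖f‖ = ∑ j, ‖f_j‖_{L^p}`. -/
abbrev LpVec (p : ℝ≥0∞) (m n : ℕ) : Type :=
  PiLp 1 fun _ : Fin m => Lp ℂ p (volume : Measure (Rn n))

/-- `L^p(ℝⁿ)₊^m`: all components are real and nonnegative almost everywhere
(the order on `ℂ` is `0 ≤ z ↔ 0 ≤ re z ∧ im z = 0`). -/
def LpVecPos (p : ℝ≥0∞) (m n : ℕ) : Set (LpVec p m n) :=
  {u | ∀ j, ∀ᵐ x : Rn n, 0 ≤ u j x}

theorem CcInf.memLp {n : ℕ} (p : ℝ≥0∞) (f : CcInf n) :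
    MemLp f p (volume : Measure (Rn n)) :=
  f.continuous.memLp_of_hasCompactSupport f.hasCompactSupport

/-- The embedding `C₀^∞(ℝⁿ)^m → L^p(ℝⁿ)^m`. -/
def testToLp (p : ℝ≥0∞) {m n : ℕ} (f : Fin m → CcInf n) : LpVec p m n :=
  WithLp.toLp 1 fun k => (CcInf.memLp p (f k)).toLp (f k)

/-- `G(-i∇)`, defined on `C₀^∞(ℝⁿ)^m`, extends to a bounded operator `T` on `L^p(ℝⁿ)^m`
with `T (L^p(ℝⁿ)₊^m) ⊆ L^p(ℝⁿ)₊^m`. -/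
def ExtendsPosPres (p : ℝ≥0∞) [Fact (1 ≤ p)] {m n : ℕ}
    (G : Rn n → Matrix (Fin m) (Fin m) ℂ) : Prop :=
  ∃ T : LpVec p m n →L[ℂ] LpVec p m n,
    (∀ (f : Fin m → CcInf n) (j : Fin m), T (testToLp p f) j =ᵐ[volume] multiplier G f j) ∧
    T '' LpVecPos p m n ⊆ LpVecPos p m n

/-- A Hermitian matrix `A` is conditionally positive semidefinite if `(c, A c) ≥ 0`
for all `c` with `∑ j, c j = 0`. -/
def CondPosSemidefMatrix {N : ℕ} (A : Matrix (Fin N) (Fin N) ℂ) : Prop :=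
  A.IsHermitian ∧ ∀ c : Fin N → ℂ, ∑ j, c j = 0 → 0 ≤ star c ⬝ᵥ (A *ᵥ c)

/-- `F : ℝⁿ → ℂ` is conditionally positive semidefinite if all the matrices
`(F (x_p - x_q))_{p,q}` are. -/
def CondPosSemidef {n : ℕ} (F : Rn n → ℂ) : Prop :=
  ∀ (N : ℕ) (x : Fin N → Rn n), CondPosSemidefMatrix (Matrix.of fun p q => F (x p - x q))

end PosPres

end

/-!
Everything splits along the diagonal: the `j`-th component of the operator is the scalar Fourier
multiplier `exp (t F_jj)`, a continuous function bounded by `exp (t c)`. That it maps test functions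
into `C₀` is the Riemann–Lebesgue lemma. The equivalence compares three conditions on `F_jj`: it is
conditionally positive semidefinite; all `exp (t F_jj)` are positive definite functions; and all
`exp (t F_jj)` act as bounded positivity preserving multipliers.

The first two are equivalent by Schoenberg's argument (`CondPosSemidef.isPosDefFun_exp`, which rests
on the Schur product theorem, and `condPosSemidef_of_isPosDefFun_exp`, which differentiates at
`t = 0`).

That a positive definite `ψ` gives a bounded positivity preserving multiplier is proved without
Bochner's theorem. Sampling independent points turns positive definiteness into nonnegativity of the
energy integral (`IsPosDefFun.integral_prod_nonneg`), and with Gaussian samples this says that the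
Fourier transform of `ψ v * exp (-a ‖v‖²)` is nonnegative. A nonnegative Fourier transform of a
continuous integrable function is integrable (`integrable_fourier_of_nonneg`), so by Fourier
inversion the regularised multiplier is convolution with a positive measure of mass `ψ 0`
(`IsPosDefFun.exists_measure`). Young's inequality and positivity hold uniformly in `a`, and survive
`a → 0` by Fatou's lemma. The passage from test functions to `L^p` uses that nonnegative test
functions are dense in the nonnegative cone (`exists_nonneg_test_eLpNorm_sub_le`).

Conversely, if the multiplier preserves positivity of test functions, evaluate the image of
`f u = |∑ conj (c r) exp (2πi ⟪x r, u⟫)|² χ (δ u)` at the origin and let `δ → 0`: the limit is the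
quadratic form `∑ conj (c r) ψ (x r - x s) c s` (`isPosDefFun_of_integral_mul_fourier_nonneg`). The
exponent `p` plays no role there, since test functions lie in every `L^p`.
-/

namespace PosPres

open FourierTransform

/-! ### Positive definite functions and Schoenberg's correspondence -/

section Matrices

variable {ι : Type*} [Fintype ι]

theorem star_dotProduct_mulVec_eq_sum (A : Matrix ι ι ℂ) (c : ι → ℂ) :
    star c ⬝ᵥ (A *ᵥ c) = ∑ r, ∑ s, star (c r) * A r s * c s := by
  simp [dotProduct, Matrix.mulVec, Finset.mul_sum, mul_assoc]

theorem posSemidef_of_tendsto {α : Type*} {l : Filter α} [l.NeBot] {B : α → Matrix ι ι ℂ}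
    {A : Matrix ι ι ℂ} (hB : ∀ᶠ k in l, (B k).PosSemidef)
    (h : ∀ r s, Tendsto (fun k => B k r s) l (𝓝 (A r s))) : A.PosSemidef := by
  rw [Matrix.posSemidef_iff_dotProduct_mulVec]
  constructor
  · ext r s
    refine tendsto_nhds_unique_of_eventuallyEq ((continuous_star.tendsto _).comp (h s r)) (h r s) ?_
    filter_upwards [hB] with k hk
    exact hk.1.apply r s
  · intro c
    rw [star_dotProduct_mulVec_eq_sum]
    refine ge_of_tendsto (x := l) (f := fun k => ∑ r, ∑ s, star (c r) * B k r s * c s) ?_ ?_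
    · exact tendsto_finsetSum _ fun r _ => tendsto_finsetSum _ fun s _ =>
        ((h r s).const_mul _).mul_const _
    · filter_upwards [hB] with k hk
      rw [← star_dotProduct_mulVec_eq_sum]
      exact hk.dotProduct_mulVec_nonneg c

theorem posSemidef_pow_entries {A : Matrix ι ι ℂ} (hA : A.PosSemidef) (k : ℕ) :
    (Matrix.of fun r s => A r s ^ k).PosSemidef := by
  induction k with
  | zero =>
    convert Matrix.posSemidef_vecMulVec_self_star (fun _ : ι => (1 : ℂ)) using 1
    ext r s
    simp [Matrix.vecMulVec_apply]
  | succ k ih =>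
    have h : (Matrix.of fun r s => A r s ^ (k + 1)) = (Matrix.of fun r s => A r s ^ k) ⊙ A := by
      ext r s
      simp [pow_succ]
    rw [h]
    exact ih.hadamard hA

/-- The entrywise exponential of a positive semidefinite matrix is positive semidefinite: by the
Schur product theorem, so is every partial sum of the entrywise exponential series. -/
theorem posSemidef_exp_entries {A : Matrix ι ι ℂ} (hA : A.PosSemidef) :
    (Matrix.of fun r s => Complex.exp (A r s)).PosSemidef := by
  refine posSemidef_of_tendsto (l := atTop)
    (B := fun k : ℕ => ∑ i ∈ Finset.range k, ((Nat.factorial i : ℝ)⁻¹ : ℝ) •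
      Matrix.of fun r s => A r s ^ i) (Eventually.of_forall fun k => ?_) fun r s => ?_
  · refine Finset.sum_induction _ Matrix.PosSemidef (fun _ _ h h' => h.add h') .zero fun i _ => ?_
    exact (posSemidef_pow_entries hA i).smul (by positivity)
  · have h := (NormedSpace.expSeries_div_hasSum_exp (A r s)).tendsto_sum_nat
    rw [← Complex.exp_eq_exp_ℂ] at h
    simpa [Matrix.sum_apply, div_eq_inv_mul] using h

end Matrices

section Schoenberg

variable {V : Type*} [AddCommGroup V]

/-- A function on an abelian group is positive definite if all the matrices
`(φ (x r - x s))` are positive semidefinite. -/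
def IsPosDefFun (φ : V → ℂ) : Prop :=
  ∀ (N : ℕ) (x : Fin N → V), (Matrix.of fun r s => φ (x r - x s)).PosSemidef

theorem IsPosDefFun.mul {φ ψ : V → ℂ} (hφ : IsPosDefFun φ) (hψ : IsPosDefFun ψ) :
    IsPosDefFun fun x => φ x * ψ x :=
  fun N x => (hφ N x).hadamard (hψ N x)

theorem IsPosDefFun.comp_smul [Module ℝ V] {φ : V → ℂ} (hφ : IsPosDefFun φ) (a : ℝ) :
    IsPosDefFun fun x => φ (a • x) := fun N x => by
  simpa [smul_sub] using hφ N fun r => a • x r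

/-- **Schoenberg**, forward direction. With `g r = F (x r) - F 0 / 2`, the matrix
`F (x r - x s) - g r - conj (g s)` is positive semidefinite, and its entrywise exponential differs
from `exp (F (x r - x s))` by a Schur factor of rank one. -/
theorem CondPosSemidef.isPosDefFun_exp {n : ℕ} {F : Rn n → ℂ} (hF : CondPosSemidef F)
    {t : ℝ} (ht : 0 ≤ t) : IsPosDefFun fun x => Complex.exp (t * F x) := by
  intro N x
  have hstar : ∀ y, star (F (-y)) = F y := fun y => by
    simpa using (hF 2 ![y, 0]).1.apply 0 1
  have hB : (Matrix.of fun r s => F (x r - x s) - F (x r) - F (-x s) + F 0 :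
      Matrix (Fin N) (Fin N) ℂ).PosSemidef := by
    rw [Matrix.posSemidef_iff_dotProduct_mulVec]
    constructor
    · ext r s
      have h1 := hstar (x r - x s)
      have h2 := hstar (x r)
      have h3 := hstar (-x s)
      have h4 := hstar 0
      simp only [neg_sub, neg_neg, neg_zero] at h1 h2 h3 h4
      simp only [Matrix.conjTranspose_apply, Matrix.of_apply, star_add, star_sub, h1, h2, h3, h4]
      ring
    · intro d
      -- Adjoin the base point `0`, weighted so that the coefficients sum to zero.
      have h := (hF (N + 1) (Fin.cons 0 x)).2 (Fin.cons (-∑ r, d r) d) (by simp [Fin.sum_univ_succ])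
      rw [star_dotProduct_mulVec_eq_sum] at h ⊢
      convert h using 1
      simp only [Fin.sum_univ_succ, Fin.cons_zero, Fin.cons_succ, Matrix.of_apply, sub_zero,
        zero_sub, star_neg, star_sum]
      simp only [mul_add, mul_sub, add_mul, sub_mul, Finset.sum_add_distrib,
        Finset.sum_sub_distrib, Finset.mul_sum, Finset.sum_mul, Finset.sum_neg_distrib, neg_mul,
        mul_neg, neg_neg]
      rw [Finset.sum_comm (f := fun r s => star (d r) * F 0 * d s),
        Finset.sum_comm (f := fun r s => star (d r) * F (-x s) * d s)]
      ring
  have hmul : (Matrix.of fun r s => (t : ℂ) * (F (x r - x s) - F (x r) - F (-x s) + F 0) :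
      Matrix (Fin N) (Fin N) ℂ).PosSemidef := by
    convert hB.smul ht using 1
    ext r s
    simp only [Matrix.smul_apply, Matrix.of_apply, Complex.real_smul]
  have heq : (Matrix.of fun r s => Complex.exp (t * F (x r - x s)) : Matrix (Fin N) (Fin N) ℂ) =
      (Matrix.of fun r s => Complex.exp (t * (F (x r - x s) - F (x r) - F (-x s) + F 0))) ⊙
        Matrix.vecMulVec (fun r => Complex.exp (t * (F (x r) - F 0 / 2)))
          (star fun r => Complex.exp (t * (F (x r) - F 0 / 2))) := by
    ext r s
    have h3 := hstar (-x s)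
    have h4 := hstar 0
    simp only [neg_neg, neg_zero, ← starRingEnd_apply] at h3 h4
    simp only [Matrix.of_apply, Matrix.hadamard_apply, Matrix.vecMulVec_apply, Pi.star_apply]
    simp only [← starRingEnd_apply, ← Complex.exp_conj, map_mul, map_sub, map_div₀,
      Complex.conj_ofReal, h3, h4, map_ofNat]
    rw [← Complex.exp_add, ← Complex.exp_add]
    congr 1
    ring
  rw [heq]
  exact (posSemidef_exp_entries hmul).hadamard (Matrix.posSemidef_vecMulVec_self_star
    fun r => Complex.exp (t * (F (x r) - F 0 / 2)))

/-- **Schoenberg**, converse direction: differentiate `exp (t F)` at `t = 0`. -/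
theorem condPosSemidef_of_isPosDefFun_exp {n : ℕ} {F : Rn n → ℂ}
    (h : ∀ t : ℝ, 0 < t → IsPosDefFun fun x => Complex.exp (t * F x)) : CondPosSemidef F := by
  intro N x
  have hlim : ∀ z : ℂ, Tendsto (fun t : ℝ => (t : ℂ)⁻¹ * (Complex.exp (t * z) - 1)) (𝓝[>] 0)
      (𝓝 z) := fun z => by
    have hd : HasDerivAt (fun t : ℝ => Complex.exp (t * z)) z 0 := by
      have := ((Complex.ofRealCLM.hasDerivAt (x := 0)).mul_const z).cexp
      simpa using this
    simpa [← Complex.coe_smul] using hd.tendsto_slope_zero_right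
  constructor
  · ext r s
    refine tendsto_nhds_unique_of_eventuallyEq
      ((continuous_star.tendsto _).comp (hlim (F (x s - x r)))) (hlim (F (x r - x s))) ?_
    filter_upwards [self_mem_nhdsWithin] with t ht
    have := (h t ht N x).1.apply r s
    simp only [Matrix.of_apply] at this
    simp [← this]
  · intro c hc
    rw [star_dotProduct_mulVec_eq_sum]
    refine ge_of_tendsto (x := 𝓝[>] (0 : ℝ)) (f := fun t : ℝ => ∑ r, ∑ s, star (c r) *
      ((t : ℂ)⁻¹ * (Complex.exp (t * F (x r - x s)) - 1)) * c s) ?_ ?_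
    · exact tendsto_finsetSum _ fun r _ => tendsto_finsetSum _ fun s _ =>
        ((hlim _).const_mul _).mul_const _
    · filter_upwards [self_mem_nhdsWithin] with t (ht : 0 < t)
      have h0 := (h t ht N x).dotProduct_mulVec_nonneg c
      rw [star_dotProduct_mulVec_eq_sum] at h0
      have : ∑ r, ∑ s, star (c r) * ((t : ℂ)⁻¹ * (Complex.exp (t * F (x r - x s)) - 1)) * c s
          = (t : ℂ)⁻¹ * ∑ r, ∑ s, star (c r) * Complex.exp (t * F (x r - x s)) * c s := by
        have h1 : ∑ r, ∑ s, star (c r) * (t : ℂ)⁻¹ * c s = 0 := by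
          simp [← Finset.mul_sum, hc]
        rw [Finset.mul_sum, ← sub_eq_zero, ← neg_eq_zero, ← h1, ← Finset.sum_sub_distrib,
          ← Finset.sum_neg_distrib]
        refine Finset.sum_congr rfl fun r _ => ?_
        rw [Finset.mul_sum, ← Finset.sum_sub_distrib, ← Finset.sum_neg_distrib]
        refine Finset.sum_congr rfl fun s _ => ?_
        ring
      rw [this]
      refine mul_nonneg ?_ h0
      rw [← Complex.ofReal_inv]
      exact_mod_cast (inv_pos.2 ht).le

end Schoenberg

/-! ### Integrated positive definiteness -/

section Sampling

variable {V : Type*} [NormedAddCommGroup V] [MeasurableSpace V] [BorelSpace V]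
  [SecondCountableTopology V]

/-- A positive definite function has nonnegative energy with respect to a probability measure `ν`.
For `N` independent samples of `ν`, the expectation of the nonnegative sum of all matrix entries
`φ (x r - x s)` is `N φ(0) + (N² - N) I`, where `I` is the energy; divide by `N²` and let
`N → ∞`. -/
theorem IsPosDefFun.integral_prod_nonneg {φ : V → ℂ} (hφ : IsPosDefFun φ) (hcont : Continuous φ)
    {C : ℝ} (hC : ∀ x, ‖φ x‖ ≤ C) (ν : Measure V) [IsProbabilityMeasure ν] :
    0 ≤ ∫ p, φ (p.1 - p.2) ∂(ν.prod ν) := by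
  set I := ∫ p, φ (p.1 - p.2) ∂(ν.prod ν) with hI
  have hN : ∀ N : ℕ, 0 ≤ (N : ℂ) * φ 0 + (N * N - N) * I := fun N => by
    let π : Measure (Fin N → V) := Measure.pi fun _ => ν
    have hint : ∀ r s, Integrable (fun x : Fin N → V => φ (x r - x s)) π := fun r s =>
      Integrable.of_bound (by fun_prop) C (Eventually.of_forall fun x => hC _)
    have hval : ∀ r s, ∫ x : Fin N → V, φ (x r - x s) ∂π = if r = s then φ 0 else I := by
      intro r s
      split_ifs with h
      · simp [h]
      · have hind : ProbabilityTheory.IndepFun (fun x : Fin N → V => x r) (fun x => x s) π :=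
          (ProbabilityTheory.iIndepFun_pi (μ := fun _ : Fin N => ν) (X := fun _ => id)
            fun _ => aemeasurable_id).indepFun h
        rw [ProbabilityTheory.indepFun_iff_map_prod_eq_prod_map_map
          (measurable_pi_apply r).aemeasurable (measurable_pi_apply s).aemeasurable,
          (measurePreserving_eval (fun _ : Fin N => ν) r).map_eq,
          (measurePreserving_eval (fun _ : Fin N => ν) s).map_eq] at hind
        rw [hI, ← hind, integral_map (by fun_prop) (by fun_prop)]
    have h0 : 0 ≤ ∫ x : Fin N → V, ∑ r, ∑ s, φ (x r - x s) ∂π :=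
      integral_nonneg fun x => by
        have := (hφ N x).dotProduct_mulVec_nonneg fun _ => 1
        rw [star_dotProduct_mulVec_eq_sum] at this
        simpa using this
    rw [integral_finsetSum _ fun r _ => integrable_finsetSum _ fun s _ => hint r s] at h0
    simp_rw [integral_finsetSum _ fun s _ => hint _ s, hval] at h0
    convert h0 using 1
    have hs : ∀ r s : Fin N, (if r = s then φ 0 else I) = I + if r = s then φ 0 - I else 0 := by
      intro r s
      split_ifs <;> ring
    simp only [hs, Finset.sum_add_distrib, Finset.sum_const, Finset.sum_ite_eq, Finset.mem_univ,
      if_true, Finset.card_univ, Fintype.card_fin, nsmul_eq_mul]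
    ring
  have hlim : Tendsto (fun k : ℕ => I + (1 / ((k : ℂ) + 1)) * (φ 0 - I)) atTop (𝓝 I) := by
    simpa using tendsto_const_nhds.add
      ((tendsto_one_div_add_atTop_nhds_zero_nat (𝕜 := ℂ)).mul_const (φ 0 - I))
  refine ge_of_tendsto hlim (Eventually.of_forall fun k => ?_)
  have hk : (0 : ℂ) ≤ ((((k : ℝ) + 1) ^ 2)⁻¹ : ℝ) := by
    rw [Complex.zero_le_real]
    positivity
  have hk1 : (k : ℂ) + 1 ≠ 0 := Nat.cast_add_one_ne_zero k
  convert mul_nonneg hk (hN (k + 1)) using 1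
  push_cast
  field_simp
  ring

end Sampling

section Gaussian

variable {V : Type*} [NormedAddCommGroup V] [InnerProductSpace ℝ V] [MeasurableSpace V]
  [BorelSpace V] [FiniteDimensional ℝ V]

theorem integrable_exp_neg_mul_sq_norm {a : ℝ} (ha : 0 < a) :
    Integrable fun x : V => Real.exp (-a * ‖x‖ ^ 2) := by
  have h := (GaussianFourier.integrable_cexp_neg_mul_sq_norm_add (V := V) (b := a)
    (by simpa using ha) 0 0).norm
  refine h.congr (Eventually.of_forall fun x => ?_)
  simp only [Complex.norm_exp]
  congr 1
  simp [← Complex.ofReal_pow]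

/-- The correlation of a Gaussian with itself is a Gaussian of twice the variance. -/
theorem integral_exp_mul_exp_add (a : ℝ) (z : V) :
    ∫ y : V, Real.exp (-a * ‖y‖ ^ 2) * Real.exp (-a * ‖z + y‖ ^ 2) =
      Real.exp (-(a / 2) * ‖z‖ ^ 2) * ∫ y : V, Real.exp (-(2 * a) * ‖y‖ ^ 2) := by
  rw [← integral_add_right_eq_self (fun y : V => Real.exp (-(2 * a) * ‖y‖ ^ 2)) ((1 / 2 : ℝ) • z),
    ← integral_const_mul]
  congr 1 with y
  rw [← Real.exp_add, ← Real.exp_add]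
  congr 1
  rw [norm_add_sq_real, norm_add_sq_real, norm_smul, inner_smul_right, real_inner_comm]
  norm_num
  ring

theorem IsPosDefFun.integral_mul_exp_nonneg {φ : V → ℂ} (hφ : IsPosDefFun φ)
    (hcont : Continuous φ) {C : ℝ} (hC : ∀ x, ‖φ x‖ ≤ C) {a : ℝ} (ha : 0 < a) :
    0 ≤ ∫ z, φ z * Real.exp (-(a / 2) * ‖z‖ ^ 2) := by
  set g : V → ℝ := fun x => Real.exp (-a * ‖x‖ ^ 2) with hg
  have hgc : Continuous g := by fun_prop
  have hgi : Integrable g := integrable_exp_neg_mul_sq_norm ha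
  have hpos : ∀ {b : ℝ}, 0 < b → 0 < ∫ x : V, Real.exp (-b * ‖x‖ ^ 2) := fun hb => by
    rw [GaussianFourier.integral_rexp_neg_mul_sq_norm hb]
    positivity
  set Z := ∫ x : V, g x with hZ
  have hZpos : 0 < Z := hpos ha
  let w : V → ℝ := fun x => Z⁻¹ * g x
  have hw0 : ∀ x, 0 ≤ w x := fun x => by positivity
  have hwm : Measurable fun x => ENNReal.ofReal (w x) := by fun_prop
  let ν : Measure V := volume.withDensity fun x => ENNReal.ofReal (w x)
  have : IsProbabilityMeasure ν := ⟨by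
    rw [withDensity_apply _ .univ, Measure.restrict_univ,
      ← ofReal_integral_eq_lintegral_ofReal (hgi.const_mul _) (Eventually.of_forall hw0),
      integral_const_mul, inv_mul_cancel₀ hZpos.ne', ENNReal.ofReal_one]⟩
  have hν : ∀ h : V → ℂ, ∫ x, h x ∂ν = ∫ x, (w x : ℂ) * h x := fun h => by
    rw [integral_withDensity_eq_integral_toReal_smul hwm (Eventually.of_forall fun x => by simp)]
    simp [ENNReal.toReal_ofReal (hw0 _)]
  have h0 := hφ.integral_prod_nonneg hcont hC ν
  have hswap : Integrable (fun p : V × V => φ p.2 * ((g p.1 * g (p.2 + p.1) : ℝ) : ℂ)) := by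
    have hmp : MeasurePreserving (fun p : V × V => (p.1, p.1 + p.2)) (volume.prod volume)
      (volume.prod volume) := measurePreserving_prod_add volume volume
    have hgg : Integrable fun p : V × V => g p.1 * g (p.2 + p.1) := by
      refine (hmp.integrable_comp_of_integrable (hgi.mul_prod hgi)).congr
        (Eventually.of_forall fun p => ?_)
      simp only [Function.comp_apply, add_comm p.1 p.2]
    exact hgg.ofReal.bdd_mul (c := C) (by fun_prop) (Eventually.of_forall fun p => hC _)
  rw [integral_prod_symm _ (Integrable.of_bound (by fun_prop) C
    (Eventually.of_forall fun x => hC _)), hν] at h0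
  simp_rw [hν] at h0
  have h1 : ∀ y : V, (∫ x : V, (w x : ℂ) * φ (x - y)) =
      ∫ z : V, (w (z + y) : ℂ) * φ z := fun y => by
    rw [← integral_sub_right_eq_self (fun z : V => (w (z + y) : ℂ) * φ z) y]
    simp
  -- Substitute `x = z + y` and integrate out `y`.
  have h2 : ∫ y : V, (w y : ℂ) * ∫ x : V, (w x : ℂ) * φ (x - y) =
      ((Z⁻¹ ^ 2 * ∫ y : V, Real.exp (-(2 * a) * ‖y‖ ^ 2) : ℝ) : ℂ) *
        ∫ z, φ z * Real.exp (-(a / 2) * ‖z‖ ^ 2) := by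
    calc _ = ∫ y : V, ∫ z : V, ((Z⁻¹ ^ 2 : ℝ) : ℂ) * (φ z * ((g y * g (z + y) : ℝ) : ℂ)) := by
          congr 1 with y
          rw [h1, ← integral_const_mul]
          congr 1 with z
          simp only [w]
          push_cast
          ring
      _ = ((Z⁻¹ ^ 2 : ℝ) : ℂ) * ∫ z : V, ∫ y : V, φ z * ((g y * g (z + y) : ℝ) : ℂ) := by
          simp_rw [integral_const_mul]
          rw [integral_integral_swap hswap]
          simp_rw [integral_const_mul]
      _ = _ := by
          have : ∀ z : V, ∫ y : V, φ z * ((g y * g (z + y) : ℝ) : ℂ) =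
              ((∫ y : V, Real.exp (-(2 * a) * ‖y‖ ^ 2) : ℝ) : ℂ) *
                (φ z * Real.exp (-(a / 2) * ‖z‖ ^ 2)) := fun z => by
            rw [integral_const_mul, integral_complex_ofReal, integral_exp_mul_exp_add]
            push_cast
            ring
          simp_rw [this, integral_const_mul]
          push_cast
          ring
  rw [h2] at h0
  set K := Z⁻¹ ^ 2 * ∫ y : V, Real.exp (-(2 * a) * ‖y‖ ^ 2) with hK
  have hKpos : 0 < K := by
    have := hpos (b := 2 * a) (by positivity)
    positivity
  have hKinv : (0 : ℂ) ≤ (K⁻¹ : ℝ) := by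
    rw [Complex.zero_le_real]
    positivity
  have := mul_nonneg hKinv h0
  rwa [← mul_assoc, ← Complex.ofReal_mul, inv_mul_cancel₀ hKpos.ne', Complex.ofReal_one,
    one_mul] at this

omit [MeasurableSpace V] [BorelSpace V] [FiniteDimensional ℝ V] in
theorem isPosDefFun_character (z : V) :
    IsPosDefFun fun v : V => ((Real.fourierChar (-inner ℝ v z) : Circle) : ℂ) := fun N x => by
  convert Matrix.posSemidef_vecMulVec_self_star
    (fun r => ((Real.fourierChar (-inner ℝ (x r) z) : Circle) : ℂ)) using 1
  ext r s
  simp only [Matrix.of_apply, Matrix.vecMulVec_apply, Pi.star_apply]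
  simp only [← starRingEnd_apply, ← Circle.coe_inv_eq_conj, ← AddChar.map_neg_eq_inv,
    ← Circle.coe_mul, ← AddChar.map_add_eq_mul,
    inner_sub_left]
  congr 2
  ring

/-- Multiplied by a Gaussian, a bounded continuous positive definite function becomes integrable,
with nonnegative Fourier transform. -/
theorem IsPosDefFun.fourier_mul_exp_nonneg {φ : V → ℂ} (hφ : IsPosDefFun φ)
    (hcont : Continuous φ) {C : ℝ} (hC : ∀ x, ‖φ x‖ ≤ C) {a : ℝ} (ha : 0 < a) (w : V) :
    0 ≤ 𝓕 (fun v => φ v * Real.exp (-a * ‖v‖ ^ 2)) w := by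
  have h := ((isPosDefFun_character w).mul hφ).integral_mul_exp_nonneg (a := 2 * a) (C := C)
    (by fun_prop) (fun x => by simpa [Circle.norm_coe] using hC x) (by positivity)
  rw [Real.fourier_eq]
  refine h.trans_eq (integral_congr_ae (Eventually.of_forall fun v => ?_))
  simp only [Circle.smul_def, smul_eq_mul, mul_assoc, mul_div_cancel_left₀ a two_ne_zero]

end Gaussian

/-! ### Integrability of nonnegative Fourier transforms -/

section Inversion

theorem lintegral_enorm_of_nonneg {α : Type*} [MeasurableSpace α] {μ : Measure α} {h : α → ℂ}
    (hi : Integrable h μ) (h0 : ∀ x, 0 ≤ h x) : ∫⁻ x, ‖h x‖ₑ ∂μ = ‖∫ x, h x ∂μ‖ₑ := by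
  have hn : ∀ x, h x = (‖h x‖ : ℂ) := fun x => (Complex.eq_coe_norm_of_nonneg (h0 x))
  have : ∫ x, h x ∂μ = ((∫ x, ‖h x‖ ∂μ : ℝ) : ℂ) := by
    rw [← integral_complex_ofReal]
    exact integral_congr_ae (Eventually.of_forall hn)
  rw [this, ← ofReal_integral_norm_eq_lintegral_enorm hi, ← ofReal_norm, Complex.norm_real,
    Real.norm_of_nonneg (integral_nonneg fun _ => norm_nonneg _)]

variable {V : Type*} [NormedAddCommGroup V] [InnerProductSpace ℝ V] [MeasurableSpace V]
  [BorelSpace V] [FiniteDimensional ℝ V]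

theorem continuous_fourier {f : V → ℂ} (hf : Integrable f) : Continuous (𝓕 f) :=
  VectorFourier.fourierIntegral_continuous Real.continuous_fourierChar
    (by exact continuous_inner) hf

theorem norm_fourier_le (f : V → ℂ) (w : V) : ‖𝓕 f w‖ ≤ ∫ v, ‖f v‖ :=
  VectorFourier.norm_fourierIntegral_le_integral_norm _ _ _ _ _

/-- If the Fourier transform of a continuous integrable function is nonnegative, then it is
integrable: the Gaussian means `∫ exp (-‖w‖² / c) 𝓕 f w` converge to `f 0` as `c → ∞`, so Fatou's
lemma applies. -/
theorem integrable_fourier_of_nonneg {f : V → ℂ} (hc : Continuous f) (hf : Integrable f)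
    (h0 : ∀ w, 0 ≤ 𝓕 f w) : Integrable (𝓕 f) := by
  refine ⟨(continuous_fourier hf).aestronglyMeasurable, ?_⟩
  let G : ℝ → V → ℂ := fun c w => Complex.exp (-(c⁻¹ : ℝ) * ‖w‖ ^ 2)
  have hGreal : ∀ c w, G c w = (Real.exp (-c⁻¹ * ‖w‖ ^ 2) : ℝ) := fun c w => by
    simp [G]
  have hGi : ∀ c : ℝ, 0 < c → Integrable (G c) := fun c hc => by
    simp_rw [funext (hGreal c)]
    exact (integrable_exp_neg_mul_sq_norm (inv_pos.2 hc)).ofReal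
  -- Move the Fourier transform to the Gaussian, which becomes an approximate identity.
  have hlim : Tendsto (fun c : ℝ => ∫ w, G c w * 𝓕 f w) atTop (𝓝 (f 0)) := by
    refine (Real.tendsto_integral_gaussian_smul' hf hc.continuousAt (v := (0 : V))).congr' ?_
    filter_upwards [Ioi_mem_atTop 0] with c (hc : 0 < c)
    have := VectorFourier.integral_fourierIntegral_smul_eq_flip (L := innerₗ V)
      Real.continuous_fourierChar continuous_inner (hGi c hc) hf
    rw [flip_innerₗ] at this
    simp only [smul_eq_mul] at this ⊢
    refine Eq.trans ?_ this
    congr 1 with w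
    congr 1
    change _ = 𝓕 (G c) w
    rw [fourier_gaussian_innerProductSpace (by simpa using hc)]
    push_cast
    congr 2
    · simp
    · rw [zero_sub, norm_neg]
      field_simp
  have hGpos : ∀ c w, 0 ≤ G c w * 𝓕 f w := fun c w => by
    refine mul_nonneg ?_ (h0 w)
    rw [hGreal, Complex.zero_le_real]
    positivity
  have hGfi : ∀ c : ℝ, 0 < c → Integrable fun w => G c w * 𝓕 f w := fun c hc =>
    (hGi c hc).mul_bdd (c := ∫ v, ‖f v‖) (continuous_fourier hf).aestronglyMeasurable
      (Eventually.of_forall (norm_fourier_le f))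
  have hlimN := hlim.comp (tendsto_natCast_atTop_atTop (R := ℝ))
  have hpt : ∀ w, Tendsto (fun k : ℕ => ‖G k w * 𝓕 f w‖ₑ) atTop (𝓝 ‖𝓕 f w‖ₑ) := fun w => by
    have h1 : Tendsto (fun k : ℕ => G k w) atTop (𝓝 1) := by
      have h2 : Tendsto (fun k : ℕ => Real.exp (-(k : ℝ)⁻¹ * ‖w‖ ^ 2)) atTop
          (𝓝 (Real.exp (-0 * ‖w‖ ^ 2))) :=
        (Real.continuous_exp.tendsto _).comp
          ((tendsto_inv_atTop_nhds_zero_nat (𝕜 := ℝ)).neg.mul_const _)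
      have h3 := (Complex.continuous_ofReal.tendsto _).comp h2
      simp only [neg_zero, zero_mul, Real.exp_zero, Complex.ofReal_one] at h3
      exact h3.congr fun k => (hGreal k w).symm
    simpa using (h1.mul_const (𝓕 f w)).enorm
  calc ∫⁻ w, ‖𝓕 f w‖ₑ = ∫⁻ w, liminf (fun k : ℕ => ‖G k w * 𝓕 f w‖ₑ) atTop :=
        lintegral_congr fun w => (hpt w).liminf_eq.symm
    _ ≤ liminf (fun k : ℕ => ∫⁻ w, ‖G k w * 𝓕 f w‖ₑ) atTop :=
        lintegral_liminf_le' fun k => by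
          have := continuous_fourier hf
          exact (by fun_prop : Continuous fun w => ‖G k w * 𝓕 f w‖ₑ).measurable.aemeasurable
    _ = ‖f 0‖ₑ := by
        refine Tendsto.liminf_eq (hlimN.enorm.congr' ?_)
        filter_upwards [Ioi_mem_atTop 0] with k hk
        exact (lintegral_enorm_of_nonneg (hGfi k (by exact_mod_cast hk)) (hGpos k)).symm
    _ < ∞ := enorm_lt_top

end Inversion

/-! ### Positive definite multipliers -/

section Multipliers

variable {V : Type*} [NormedAddCommGroup V] [InnerProductSpace ℝ V] [MeasurableSpace V]
  [BorelSpace V] [FiniteDimensional ℝ V]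

/-- Young's inequality for the convolution with a finite measure. -/
theorem eLpNorm_integral_translate_le {f : V → ℂ} (hf : Continuous f) (ν : Measure V)
    [IsFiniteMeasure ν] {p : ℝ≥0∞} (hp1 : 1 ≤ p) (hp : p ≠ ∞) :
    eLpNorm (fun x => ∫ u, f (x + u) ∂ν) p volume ≤ ν Set.univ * eLpNorm f p volume := by
  have hp0 : p ≠ 0 := (zero_lt_one.trans_le hp1).ne'
  set r := p.toReal with hr
  have hr0 : 0 < r := ENNReal.toReal_pos hp0 hp
  have hr1 : 1 ≤ r := by simpa using ENNReal.toReal_mono hp hp1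
  have hpt : ∀ x, ‖∫ u, f (x + u) ∂ν‖ₑ ^ r ≤
      ν Set.univ ^ (r - 1) * ∫⁻ u, ‖f (x + u)‖ₑ ^ r ∂ν := fun x => by
    have h1 : ‖∫ u, f (x + u) ∂ν‖ₑ ≤
        (∫⁻ u, ‖f (x + u)‖ₑ ^ r ∂ν) ^ (1 / r) * ν Set.univ ^ (1 - 1 / r) := by
      refine (enorm_integral_le_lintegral_enorm _).trans ?_
      rw [← eLpNorm_one_eq_lintegral_enorm]
      refine (eLpNorm_le_eLpNorm_mul_rpow_measure_univ hp1 (by fun_prop)).trans_eq ?_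
      rw [eLpNorm_eq_lintegral_rpow_enorm_toReal hp0 hp, ENNReal.toReal_one, div_one, hr]
    refine (ENNReal.rpow_le_rpow h1 hr0.le).trans_eq ?_
    rw [ENNReal.mul_rpow_of_nonneg _ _ hr0.le, ← ENNReal.rpow_mul, ← ENNReal.rpow_mul,
      one_div_mul_cancel hr0.ne', ENNReal.rpow_one, sub_mul, one_div_mul_cancel hr0.ne', one_mul,
      mul_comm]
  rw [eLpNorm_eq_lintegral_rpow_enorm_toReal hp0 hp, eLpNorm_eq_lintegral_rpow_enorm_toReal hp0 hp,
    ← hr]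
  have hle : ∫⁻ x, ‖∫ u, f (x + u) ∂ν‖ₑ ^ r ≤ ν Set.univ ^ r * ∫⁻ x, ‖f x‖ₑ ^ r := by
    refine (lintegral_mono hpt).trans_eq ?_
    rw [lintegral_const_mul' _ _ (ENNReal.rpow_ne_top_of_nonneg (by linarith) (measure_ne_top _ _)),
      lintegral_lintegral_swap (by
        refine Measurable.aemeasurable ?_
        exact (hf.comp (continuous_fst.add continuous_snd)).measurable.enorm.pow_const r)]
    have : ∀ u, ∫⁻ x, ‖f (x + u)‖ₑ ^ r = ∫⁻ x, ‖f x‖ₑ ^ r := fun u =>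
      lintegral_add_right_eq_self (fun x => ‖f x‖ₑ ^ r) u
    simp_rw [this]
    rw [lintegral_const, mul_comm (∫⁻ x, ‖f x‖ₑ ^ r), ← mul_assoc]
    congr 1
    nth_rw 2 [← ENNReal.rpow_one (ν Set.univ)]
    rw [← ENNReal.rpow_add_of_nonneg _ _ (by linarith) zero_le_one, sub_add_cancel]
  refine (ENNReal.rpow_le_rpow hle (by positivity)).trans_eq ?_
  rw [ENNReal.mul_rpow_of_nonneg _ _ (by positivity), ← ENNReal.rpow_mul,
    mul_one_div_cancel hr0.ne', ENNReal.rpow_one]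

/-- The operator with Fourier multiplier `ψ v * exp (-a ‖v‖²)`, where `ψ` is positive definite, is
the convolution with a finite measure of total mass `ψ 0`. -/
theorem IsPosDefFun.exists_measure {ψ : V → ℂ} (hψ : IsPosDefFun ψ)
    (hcont : Continuous ψ) {C : ℝ} (hC : ∀ x, ‖ψ x‖ ≤ C) {a : ℝ} (ha : 0 < a) :
    ∃ ν : Measure V, ν Set.univ = ‖ψ 0‖ₑ ∧ ∀ f : V → ℂ, Integrable f → ∀ x,
      𝓕⁻ (fun v => ψ v * Real.exp (-a * ‖v‖ ^ 2) * 𝓕 f v) x = ∫ u, f (x + u) ∂ν := by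
  set ψa : V → ℂ := fun v => ψ v * Real.exp (-a * ‖v‖ ^ 2) with hψa
  have hc : Continuous ψa := by fun_prop
  have hi : Integrable ψa :=
    (integrable_exp_neg_mul_sq_norm ha).ofReal.bdd_mul (c := C) (by fun_prop)
      (Eventually.of_forall hC)
  have h0 : ∀ w, 0 ≤ 𝓕 ψa w := hψ.fourier_mul_exp_nonneg hcont hC ha
  have hki := integrable_fourier_of_nonneg hc hi h0
  have hkm : Measurable fun u => ‖𝓕 ψa u‖ₑ := (continuous_fourier hi).measurable.enorm
  refine ⟨volume.withDensity fun u => ‖𝓕 ψa u‖ₑ, ?_, fun f hf x => ?_⟩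
  · rw [withDensity_apply _ .univ, Measure.restrict_univ, lintegral_enorm_of_nonneg hki h0]
    have h1 := congrFun (hc.fourierInv_fourier_eq hi hki) 0
    rw [Real.fourierInv_eq] at h1
    simp only [inner_zero_right, AddChar.map_zero_eq_one, one_smul] at h1
    rw [h1]
    simp [hψa]
  · rw [integral_withDensity_eq_integral_toReal_smul hkm (Eventually.of_forall fun u => by simp)]
    have h2 : ∀ u, (‖𝓕 ψa u‖ₑ).toReal • f (x + u) = 𝓕 ψa u * f (x + u) := fun u => by
      rw [toReal_enorm, ← Complex.coe_smul, smul_eq_mul, ← Complex.eq_coe_norm_of_nonneg (h0 u)]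
    simp_rw [h2]
    have h3 := VectorFourier.integral_fourierIntegral_smul_eq_flip (L := innerₗ V)
      Real.continuous_fourierChar continuous_inner hi (hf.comp_add_left x)
    rw [flip_innerₗ] at h3
    simp only [smul_eq_mul] at h3
    refine Eq.trans ?_ h3.symm
    rw [Real.fourierInv_eq]
    congr 1 with v
    have h4 := congrFun (VectorFourier.fourierIntegral_comp_add_right Real.fourierChar volume
      (innerₗ V) f x) v
    simp only [Function.comp_def, add_comm _ x] at h4
    rw [h4]
    simp only [Circle.smul_def, smul_eq_mul, innerₗ_apply_apply, real_inner_comm]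
    change _ = ψa v * (_ * 𝓕 f v)
    ring

theorem tendsto_fourierInv_mul_exp {ψ : V → ℂ} (hcont : Continuous ψ) {C : ℝ}
    (hC : ∀ x, ‖ψ x‖ ≤ C) {g : V → ℂ} (hg : Integrable g) (x : V) :
    Tendsto (fun k : ℕ => 𝓕⁻ (fun v => ψ v * Real.exp (-(1 / ((k : ℝ) + 1)) * ‖v‖ ^ 2) * g v) x)
      atTop (𝓝 (𝓕⁻ (fun v => ψ v * g v) x)) := by
  simp_rw [Real.fourierInv_eq]
  refine tendsto_integral_of_dominated_convergence (fun v => C * ‖g v‖) (fun k => ?_)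
    (hg.norm.const_mul C) (fun k => Eventually.of_forall fun v => ?_)
    (Eventually.of_forall fun v => ?_)
  · have := hg.aestronglyMeasurable
    simp only [Circle.smul_def]
    fun_prop
  · rw [Circle.norm_smul, norm_mul, norm_mul, Complex.norm_real, Real.norm_eq_abs, Real.abs_exp]
    refine mul_le_mul_of_nonneg_right ?_ (norm_nonneg _)
    refine (mul_le_of_le_one_right (norm_nonneg _) ?_).trans (hC v)
    rw [Real.exp_le_one_iff, neg_mul, neg_nonpos]
    positivity
  · refine Tendsto.const_smul (Tendsto.mul_const _ ?_) _
    have h2 : Tendsto (fun k : ℕ => Real.exp (-(1 / ((k : ℝ) + 1)) * ‖v‖ ^ 2)) atTop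
        (𝓝 (Real.exp (-0 * ‖v‖ ^ 2))) :=
      (Real.continuous_exp.tendsto _).comp
        ((tendsto_one_div_add_atTop_nhds_zero_nat (𝕜 := ℝ)).neg.mul_const _)
    have h3 := ((Complex.continuous_ofReal.tendsto _).comp h2).const_mul (ψ v)
    simpa only [Function.comp_apply, neg_zero, zero_mul, Real.exp_zero, Complex.ofReal_one,
      mul_one] using h3

theorem continuous_fourierInv {f : V → ℂ} (hf : Integrable f) : Continuous (𝓕⁻ f) := by
  rw [Real.fourierInv_eq_fourier_comp_neg]
  exact continuous_fourier hf.comp_neg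

/-- A positive definite multiplier is positivity preserving. -/
theorem IsPosDefFun.fourierInv_mul_fourier_nonneg {ψ : V → ℂ} (hψ : IsPosDefFun ψ)
    (hcont : Continuous ψ) {C : ℝ} (hC : ∀ x, ‖ψ x‖ ≤ C) {f : V → ℂ} (hf : Integrable f)
    (hf' : Integrable (𝓕 f)) (h0 : ∀ x, 0 ≤ f x) (x : V) :
    0 ≤ 𝓕⁻ (fun v => ψ v * 𝓕 f v) x := by
  refine ge_of_tendsto (tendsto_fourierInv_mul_exp hcont hC hf' x)
    (Eventually.of_forall fun k => ?_)
  obtain ⟨ν, -, hν⟩ := hψ.exists_measure hcont hC (a := 1 / ((k : ℝ) + 1)) (by positivity)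
  rw [hν f hf x]
  exact integral_nonneg fun u => h0 _

/-- A positive definite multiplier is bounded on `L^p`. -/
theorem IsPosDefFun.eLpNorm_fourierInv_mul_fourier_le {ψ : V → ℂ} (hψ : IsPosDefFun ψ)
    (hcont : Continuous ψ) {C : ℝ} (hC : ∀ x, ‖ψ x‖ ≤ C) {f : V → ℂ} (hfc : Continuous f)
    (hf : Integrable f) (hf' : Integrable (𝓕 f)) {p : ℝ≥0∞} (hp1 : 1 ≤ p) (hp : p ≠ ∞) :
    eLpNorm (𝓕⁻ (fun v => ψ v * 𝓕 f v)) p volume ≤ ‖ψ 0‖ₑ * eLpNorm f p volume := by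
  have hint : ∀ k : ℕ, Integrable fun v =>
      ψ v * Real.exp (-(1 / ((k : ℝ) + 1)) * ‖v‖ ^ 2) * 𝓕 f v := fun k => by
    refine hf'.bdd_mul (c := C) (by fun_prop) (Eventually.of_forall fun v => ?_)
    rw [norm_mul, Complex.norm_real, Real.norm_eq_abs, Real.abs_exp]
    refine (mul_le_of_le_one_right (norm_nonneg _) ?_).trans (hC v)
    rw [Real.exp_le_one_iff, neg_mul, neg_nonpos]
    positivity
  refine (Lp.eLpNorm_lim_le_liminf_eLpNorm
    (fun k => (continuous_fourierInv (hint k)).aestronglyMeasurable) _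
    (Eventually.of_forall fun x => tendsto_fourierInv_mul_exp hcont hC hf' x)).trans ?_
  refine liminf_le_of_le (by isBoundedDefault) fun b hb => ?_
  obtain ⟨k, hk⟩ := hb.exists
  refine hk.trans ?_
  obtain ⟨ν, hν1, hν⟩ := hψ.exists_measure hcont hC (a := 1 / ((k : ℝ) + 1)) (by positivity)
  have : IsFiniteMeasure ν := ⟨by rw [hν1]; exact enorm_lt_top⟩
  rw [funext (hν f hf), ← hν1]
  exact eLpNorm_integral_translate_le hfc ν hp1 hp

end Multipliers

/-! ### Test functions and the two normalisations of the Fourier transform -/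

section TestFunctions

variable {n : ℕ}

theorem hat_eq_fourier (f : Rn n → ℂ) (y : Rn n) :
    hat f y = ((2 * Real.pi) ^ (-(n : ℝ) / 2) : ℝ) * 𝓕 f ((2 * Real.pi)⁻¹ • y) := by
  rw [hat, Real.fourier_eq']
  congr 2 with x
  rw [smul_eq_mul, inner_smul_right, real_inner_comm]
  congr 2
  push_cast
  field_simp

/-- In the normalisation of `𝓕`, the multiplier `φ` becomes its dilation `v ↦ φ (2πv)`. -/
theorem check_mul_hat (φ f : Rn n → ℂ) :
    check (fun y => φ y * hat f y) = 𝓕⁻ (fun v => φ ((2 * Real.pi) • v) * 𝓕 f v) := by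
  ext x
  have hπ : (0 : ℝ) < 2 * Real.pi := by positivity
  set c : ℝ := (2 * Real.pi) ^ (-(n : ℝ) / 2) with hc
  have hcc : c * c * (2 * Real.pi) ^ n = 1 := by
    rw [hc, ← Real.rpow_add hπ, ← Real.rpow_natCast, ← Real.rpow_add hπ]
    ring_nf
    exact Real.rpow_zero _
  have h1 := Measure.integral_comp_smul (volume : Measure (Rn n))
    (fun y => Complex.exp (Complex.I * (inner ℝ x y : ℝ)) * (φ y * hat f y)) (2 * Real.pi)
  rw [finrank_euclideanSpace_fin, abs_of_pos (by positivity), eq_inv_smul_iff₀ (by positivity)]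
    at h1
  rw [check, ← h1, Real.fourierInv_eq', ← Complex.coe_smul, smul_eq_mul, ← mul_assoc,
    ← integral_const_mul]
  congr 1 with v
  rw [hat_eq_fourier, inv_smul_smul₀ hπ.ne', inner_smul_right, real_inner_comm, smul_eq_mul, ← hc]
  have h2 : (c : ℂ) * c * ((2 * Real.pi) ^ n : ℝ) = 1 := by exact_mod_cast hcc
  calc _ = ((c : ℂ) * c * ((2 * Real.pi) ^ n : ℝ)) *
        (Complex.exp (Complex.I * ((2 * Real.pi * inner ℝ v x : ℝ))) *
          (φ ((2 * Real.pi) • v) * 𝓕 f v)) := by ring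
    _ = _ := by
      rw [h2, one_mul]
      congr 2
      ring

theorem integrable_test (f : CcInf n) : Integrable (f : Rn n → ℂ) :=
  f.continuous.integrable_of_hasCompactSupport f.hasCompactSupport

theorem integrable_fourier_test (f : CcInf n) : Integrable (𝓕 (f : Rn n → ℂ)) := by
  have h := (𝓕 (f.hasCompactSupport.toSchwartzMap f.contDiff)).integrable (μ := volume)
  rwa [SchwartzMap.fourier_coe] at h

theorem integrable_mul_fourier_test {φ : Rn n → ℂ} (hφ : Continuous φ) {C : ℝ}
    (hC : ∀ y, ‖φ y‖ ≤ C) (f : CcInf n) (a : ℝ) :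
    Integrable fun v => φ (a • v) * 𝓕 (f : Rn n → ℂ) v :=
  (integrable_fourier_test f).bdd_mul (c := C) (by fun_prop) (Eventually.of_forall fun _ => hC _)

theorem fourier_test_add (f g : CcInf n) (v : Rn n) :
    𝓕 (⇑(f + g)) v = 𝓕 (⇑f) v + 𝓕 (⇑g) v := by
  exact congrFun (VectorFourier.fourierIntegral_add Real.continuous_fourierChar
    (by exact continuous_inner) (integrable_test f) (integrable_test g)) v

theorem fourier_test_smul (a : ℂ) (f : CcInf n) (v : Rn n) :
    𝓕 (⇑(a • f)) v = a * 𝓕 (⇑f) v := by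
  exact congrFun (VectorFourier.fourierIntegral_const_smul Real.fourierChar volume
    (innerₗ (Rn n)) (f : Rn n → ℂ) a) v

theorem check_mul_hat_add {φ : Rn n → ℂ} (hφ : Continuous φ) {C : ℝ} (hC : ∀ y, ‖φ y‖ ≤ C)
    (f g : CcInf n) (x : Rn n) :
    check (fun y => φ y * hat (⇑(f + g)) y) x =
      check (fun y => φ y * hat f y) x + check (fun y => φ y * hat g y) x := by
  simp_rw [check_mul_hat, Real.fourierInv_eq_fourier_neg, fourier_test_add, mul_add]
  exact congrFun (VectorFourier.fourierIntegral_add Real.continuous_fourierChar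
    (by exact continuous_inner) (integrable_mul_fourier_test hφ hC f _)
    (integrable_mul_fourier_test hφ hC g _)) (-x)

theorem check_mul_hat_smul (φ : Rn n → ℂ) (a : ℂ) (f : CcInf n) (x : Rn n) :
    check (fun y => φ y * hat (⇑(a • f)) y) x = a * check (fun y => φ y * hat f y) x := by
  simp_rw [check_mul_hat, Real.fourierInv_eq_fourier_neg, fourier_test_smul, mul_left_comm _ a]
  exact congrFun (VectorFourier.fourierIntegral_const_smul Real.fourierChar volume
    (innerₗ (Rn n)) (fun v => φ ((2 * Real.pi) • v) * 𝓕 (f : Rn n → ℂ) v) a) (-x)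

theorem continuous_check_mul_hat {φ : Rn n → ℂ} (hφ : Continuous φ) {C : ℝ}
    (hC : ∀ y, ‖φ y‖ ≤ C) (f : CcInf n) : Continuous (check fun y => φ y * hat f y) := by
  rw [check_mul_hat]
  exact continuous_fourierInv (integrable_mul_fourier_test hφ hC f _)

/-- The Riemann–Lebesgue lemma. -/
theorem tendsto_check_mul_hat (φ f : Rn n → ℂ) :
    Tendsto (check fun y => φ y * hat f y) (cocompact (Rn n)) (𝓝 0) := by
  rw [check_mul_hat, funext (Real.fourierInv_eq_fourier_neg _)]
  simp_rw [Real.fourier_eq]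
  exact (tendsto_integral_exp_inner_smul_cocompact _).comp
    (Homeomorph.neg (Rn n)).isClosedEmbedding.tendsto_cocompact

end TestFunctions

/-! ### Extension to `L^p` -/

section Extension

variable {n : ℕ} {p : ℝ≥0∞}

/-- A smooth compactly supported function as an element of `C₀^∞`. -/
def mkTest (g : Rn n → ℂ) (h1 : ContDiff ℝ (⊤ : ℕ∞) g) (h2 : HasCompactSupport g) : CcInf n :=
  ⟨g, h1, h2, fun _ _ => trivial⟩

/-- The embedding `C₀^∞ → L^p` of scalar functions. -/
noncomputable def testToLpScalar (p : ℝ≥0∞) : CcInf n →ₗ[ℂ] Lp ℂ p (volume : Measure (Rn n)) where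
  toFun f := (CcInf.memLp p f).toLp f
  map_add' _ _ := rfl
  map_smul' _ _ := rfl

theorem denseRange_testToLpScalar [hp1 : Fact (1 ≤ p)] (hp : p ≠ ∞) :
    DenseRange (testToLpScalar (n := n) p) := by
  refine (Lp.dense_hasCompactSupport_contDiff (F := ℂ) (μ := (volume : Measure (Rn n)))
    hp).mono ?_
  rintro f ⟨g, hfg, hg1, hg2⟩
  refine ⟨mkTest g hg2 hg1, ?_⟩
  exact Lp.ext ((CcInf.memLp p (mkTest g hg2 hg1)).coeFn_toLp.trans hfg.symm)

/-- Nonnegative test functions are dense in the nonnegative cone of `L^p`: if the test function `h`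
approximates `√u` in `L^{2p}`, then `h²` approximates `u` in `L^p`, by Hölder's inequality. -/
theorem exists_nonneg_test_eLpNorm_sub_le [hp1 : Fact (1 ≤ p)] (hp : p ≠ ∞)
    (u : Lp ℂ p (volume : Measure (Rn n))) (hu : ∀ᵐ x, 0 ≤ u x) {ε : ℝ} (hε : 0 < ε) :
    ∃ f : CcInf n, (∀ x, 0 ≤ f x) ∧ eLpNorm (⇑u - ⇑f) p volume ≤ ENNReal.ofReal ε := by
  set q : ℝ≥0∞ := p / 2⁻¹ with hq
  have hq2 : q = p * 2 := by rw [hq, div_eq_mul_inv, inv_inv]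
  have hqtop : q ≠ ∞ := by
    rw [hq2]
    exact ENNReal.mul_ne_top hp (by simp)
  have hq1 : 1 ≤ q := by
    rw [hq2]
    exact hp1.out.trans (le_mul_of_one_le_right' one_le_two)
  have : ENNReal.HolderTriple q q p := ⟨by
    rw [hq2, ENNReal.mul_inv (by simp) (by simp), ← mul_add, ENNReal.inv_two_add_inv_two, mul_one]⟩
  set s : Rn n → ℝ := fun x => ‖u x‖ ^ (2⁻¹ : ℝ) with hs
  have hsq : MemLp s q volume := by
    simpa using (Lp.memLp u).norm_rpow_div 2⁻¹
  set S := (eLpNorm s q volume).toReal with hS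
  set δ : ℝ := min 1 (ε / (2 * S + 1)) with hδ
  have hS0 : 0 ≤ S := ENNReal.toReal_nonneg
  have hδ0 : 0 < δ := by positivity
  obtain ⟨h, hh1, hh2, hh3⟩ := hsq.exist_eLpNorm_sub_le hqtop hq1 hδ0
  have hf2 : ContDiff ℝ (⊤ : ℕ∞) fun x => ((h x ^ 2 : ℝ) : ℂ) :=
    Complex.ofRealCLM.contDiff.comp (hh2.pow 2)
  have hf1 : HasCompactSupport fun x => ((h x ^ 2 : ℝ) : ℂ) :=
    hh1.comp_left (g := fun y : ℝ => ((y ^ 2 : ℝ) : ℂ)) (by simp)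
  refine ⟨mkTest _ hf2 hf1, fun x => ?_, ?_⟩
  · change (0 : ℂ) ≤ ((h x ^ 2 : ℝ) : ℂ)
    rw [Complex.zero_le_real]
    positivity
  · have hae : ∀ᵐ x, ‖(⇑u - ⇑(mkTest _ hf2 hf1)) x‖ = ‖((s - h) • (s + h)) x‖ := by
      filter_upwards [hu] with x hx
      have h1 : u x = ((s x ^ 2 : ℝ) : ℂ) := by
        rw [hs, ← Real.rpow_natCast, ← Real.rpow_mul (norm_nonneg _)]
        simpa using Complex.eq_coe_norm_of_nonneg hx
      have h2 : (mkTest _ hf2 hf1) x = ((h x ^ 2 : ℝ) : ℂ) := rfl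
      rw [Pi.sub_apply, h1, h2, ← Complex.ofReal_sub, Complex.norm_real]
      congr 1
      simp only [Pi.smul_apply', Pi.sub_apply, Pi.add_apply, smul_eq_mul]
      ring
    have hhm : AEStronglyMeasurable h volume := hh2.continuous.aestronglyMeasurable
    have hsm := hsq.aestronglyMeasurable
    have hsh : eLpNorm (s + h) q volume ≤ ENNReal.ofReal (2 * S + δ) := by
      have : s + h = (s + s) - (s - h) := by
        ext x
        simp only [Pi.sub_apply, Pi.add_apply]
        ring
      rw [this]
      refine (eLpNorm_sub_le (hsm.add hsm) (hsm.sub hhm) hq1).trans ?_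
      rw [ENNReal.ofReal_add (by positivity) hδ0.le, two_mul, ENNReal.ofReal_add hS0 hS0, hS,
        ENNReal.ofReal_toReal hsq.eLpNorm_ne_top]
      exact add_le_add (eLpNorm_add_le hsm hsm hq1) hh3
    rw [eLpNorm_congr_norm_ae hae]
    refine (eLpNorm_smul_le_mul_eLpNorm (p := q) (q := q) (hsm.add hhm) (hsm.sub hhm)).trans ?_
    refine (mul_le_mul' hh3 hsh).trans ?_
    rw [← ENNReal.ofReal_mul hδ0.le]
    refine ENNReal.ofReal_le_ofReal ?_
    calc δ * (2 * S + δ) ≤ ε / (2 * S + 1) * (2 * S + 1) := by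
          gcongr
          · exact min_le_right _ _
          · exact min_le_left _ _
      _ = ε := by field_simp

theorem ae_nonneg_of_tendsto [hp1 : Fact (1 ≤ p)] {g : ℕ → Lp ℂ p (volume : Measure (Rn n))}
    {u : Lp ℂ p (volume : Measure (Rn n))} (hg : Tendsto g atTop (𝓝 u))
    (h0 : ∀ k, ∀ᵐ x, 0 ≤ g k x) : ∀ᵐ x, 0 ≤ u x := by
  obtain ⟨ns, -, hns⟩ := (tendstoInMeasure_of_tendsto_Lp hg).exists_seq_tendsto_ae
  filter_upwards [hns, ae_all_iff.2 h0] with x hx hx0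
  exact ge_of_tendsto hx (Eventually.of_forall fun k => hx0 _)

/-- A bounded continuous positive definite multiplier extends to a bounded positivity preserving
operator on `L^p`. -/
theorem IsPosDefFun.exists_extension {φ : Rn n → ℂ} (hφ : IsPosDefFun φ) (hcont : Continuous φ)
    {C : ℝ} (hC : ∀ y, ‖φ y‖ ≤ C) [hp1 : Fact (1 ≤ p)] (hp : p ≠ ∞) :
    ∃ T : Lp ℂ p (volume : Measure (Rn n)) →L[ℂ] Lp ℂ p (volume : Measure (Rn n)),
      (∀ f : CcInf n, T (testToLpScalar p f) =ᵐ[volume] check fun y => φ y * hat f y) ∧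
      ∀ u, (∀ᵐ x, 0 ≤ u x) → ∀ᵐ x, 0 ≤ T u x := by
  have hψ := hφ.comp_smul (2 * Real.pi)
  have hψc : Continuous fun v => φ ((2 * Real.pi) • v) := by fun_prop
  have hψC : ∀ v, ‖φ ((2 * Real.pi) • v)‖ ≤ C := fun v => hC _
  have hle : ∀ f : CcInf n, eLpNorm (check fun y => φ y * hat f y) p volume ≤
      ‖φ 0‖ₑ * eLpNorm f p volume := fun f => by
    rw [check_mul_hat]
    simpa using hψ.eLpNorm_fourierInv_mul_fourier_le hψc hψC f.continuous (integrable_test f)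
      (integrable_fourier_test f) hp1.out hp
  have hmem : ∀ f : CcInf n, MemLp (check fun y => φ y * hat f y) p volume := fun f =>
    ⟨(continuous_check_mul_hat hcont hC f).aestronglyMeasurable,
      (hle f).trans_lt (ENNReal.mul_lt_top enorm_lt_top (CcInf.memLp p f).2)⟩
  let T0 : CcInf n →ₗ[ℂ] Lp ℂ p (volume : Measure (Rn n)) :=
    { toFun := fun f => (hmem f).toLp _
      map_add' := fun f g => by
        rw [← MemLp.toLp_add]
        exact MemLp.toLp_congr _ _ (Eventually.of_forall (check_mul_hat_add hcont hC f g))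
      map_smul' := fun a f => by
        rw [RingHom.id_apply, ← MemLp.toLp_const_smul]
        exact MemLp.toLp_congr _ _ (Eventually.of_forall (check_mul_hat_smul φ a f)) }
  have hnorm : ∀ f, ‖T0 f‖ ≤ ‖φ 0‖ * ‖testToLpScalar p f‖ := fun f => by
    change ‖(hmem f).toLp _‖ ≤ ‖φ 0‖ * ‖(CcInf.memLp p f).toLp f‖
    rw [Lp.norm_toLp, Lp.norm_toLp, ← toReal_enorm (φ 0), ← ENNReal.toReal_mul]
    exact ENNReal.toReal_mono (ENNReal.mul_ne_top enorm_ne_top (CcInf.memLp p f).2.ne) (hle f)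
  have hd := denseRange_testToLpScalar (n := n) hp
  set T := T0.extendOfNorm (testToLpScalar p) with hT
  have hTf : ∀ f : CcInf n, T (testToLpScalar p f) =ᵐ[volume] check fun y => φ y * hat f y :=
    fun f => by
      rw [hT, LinearMap.extendOfNorm_eq hd ⟨_, hnorm⟩]
      exact (hmem f).coeFn_toLp
  refine ⟨T, hTf, fun u hu => ?_⟩
  choose f hf0 hf using fun k : ℕ => exists_nonneg_test_eLpNorm_sub_le hp u hu
    (ε := 1 / ((k : ℝ) + 1)) (by positivity)
  have hlim : Tendsto (fun k => testToLpScalar p (f k)) atTop (𝓝 u) := by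
    rw [tendsto_iff_dist_tendsto_zero]
    refine squeeze_zero (fun _ => dist_nonneg) (fun k => ?_)
      (tendsto_one_div_add_atTop_nhds_zero_nat (𝕜 := ℝ))
    rw [dist_comm, Lp.dist_def]
    refine ENNReal.toReal_le_of_le_ofReal (by positivity) ((eLpNorm_congr_ae ?_).trans_le (hf k))
    exact EventuallyEq.rfl.sub (CcInf.memLp p (f k)).coeFn_toLp
  refine ae_nonneg_of_tendsto ((T.continuous.tendsto u).comp hlim) fun k => ?_
  filter_upwards [hTf (f k)] with x hx
  rw [Function.comp_apply, hx, check_mul_hat]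
  exact hψ.fourierInv_mul_fourier_nonneg hψc hψC (integrable_test _) (integrable_fourier_test _)
    (hf0 k) x

end Extension

/-! ### Positivity preserving multipliers are positive definite -/

section Converse

/-- Over `ℂ`, nonnegativity of the quadratic form already forces the matrix to be Hermitian. -/
theorem posSemidef_of_dotProduct_nonneg {N : ℕ} {A : Matrix (Fin N) (Fin N) ℂ}
    (h : ∀ c : Fin N → ℂ, 0 ≤ star c ⬝ᵥ (A *ᵥ c)) : A.PosSemidef := by
  rw [← Matrix.isPositive_toEuclideanLin_iff, LinearMap.isPositive_iff_complex]
  intro x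
  have hx := h x.ofLp
  have heq : inner ℂ (A.toEuclideanLin x) x = star (star x.ofLp ⬝ᵥ (A *ᵥ x.ofLp)) := by
    rw [EuclideanSpace.inner_eq_star_dotProduct, Matrix.ofLp_toLpLin, Matrix.toLin'_apply,
      Matrix.star_dotProduct, star_star, dotProduct_comm]
  rw [heq, ← starRingEnd_apply, Complex.conj_eq_iff_im.2 (Complex.nonneg_iff.1 hx).2.symm]
  exact ⟨(Complex.eq_re_of_ofReal_le hx).symm, (Complex.nonneg_iff.1 hx).1⟩

variable {n : ℕ}

theorem fourier_comp_smul (g : Rn n → ℂ) {δ : ℝ} (hδ : 0 < δ) (w : Rn n) :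
    𝓕 (fun u => g (δ • u)) (δ • w) = ((δ ^ n)⁻¹ : ℝ) * 𝓕 g w := by
  have h := Measure.integral_comp_smul_of_nonneg (volume : Measure (Rn n))
    (fun u => Complex.exp (((-2 * Real.pi * inner ℝ u w : ℝ) : ℂ) * Complex.I) • g u) δ
    (hR := hδ.le)
  rw [finrank_euclideanSpace_fin, ← Complex.coe_smul, smul_eq_mul] at h
  rw [Real.fourier_eq', Real.fourier_eq', ← h]
  congr 1 with u
  rw [real_inner_smul_right, real_inner_smul_left]

theorem integral_mul_fourier_comp_smul (h g : Rn n → ℂ) {δ : ℝ} (hδ : 0 < δ) :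
    ∫ v, h v * 𝓕 (fun u => g (δ • u)) v = ∫ w, h (δ • w) * 𝓕 g w := by
  have h1 := Measure.integral_comp_smul_of_nonneg (volume : Measure (Rn n))
    (fun v => h v * 𝓕 (fun u => g (δ • u)) v) δ (hR := hδ.le)
  rw [finrank_euclideanSpace_fin, eq_inv_smul_iff₀ (by positivity)] at h1
  rw [← h1, ← Complex.coe_smul, smul_eq_mul, ← integral_const_mul]
  congr 1 with w
  rw [fourier_comp_smul g hδ]
  have : ((δ ^ n : ℝ) : ℂ) ≠ 0 := by
    rw [Complex.ofReal_ne_zero]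
    positivity
  rw [Complex.ofReal_inv]
  field_simp

theorem fourier_modulation_mul (d : Rn n) (g : Rn n → ℂ) (v : Rn n) :
    𝓕 (fun u => Complex.exp (((2 * Real.pi * inner ℝ d u : ℝ) : ℂ) * Complex.I) * g u) v =
      𝓕 g (v - d) := by
  rw [Real.fourier_eq', Real.fourier_eq']
  congr 1 with u
  rw [smul_eq_mul, smul_eq_mul, ← mul_assoc, ← Complex.exp_add, inner_sub_right,
    real_inner_comm u d]
  congr 2
  push_cast
  ring

/-- The functional `f ↦ ∫ ψ · 𝓕 f` on test functions, i.e. the value at the origin of the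
operator with multiplier `ψ`. -/
noncomputable def fourierPairing {ψ : Rn n → ℂ} (hcont : Continuous ψ) {C : ℝ}
    (hC : ∀ x, ‖ψ x‖ ≤ C) : CcInf n →ₗ[ℂ] ℂ where
  toFun f := ∫ v, ψ v * 𝓕 (f : Rn n → ℂ) v
  map_add' f g := by
    have hi : ∀ f : CcInf n, Integrable fun v => ψ v * 𝓕 (f : Rn n → ℂ) v := fun f => by
      simpa using integrable_mul_fourier_test hcont hC f 1
    simp_rw [fourier_test_add, mul_add]
    exact integral_add (hi f) (hi g)
  map_smul' a f := by
    simp_rw [fourier_test_smul, mul_left_comm _ a, integral_const_mul]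
    simp

/-- If `∫ ψ · 𝓕 f ≥ 0` for all nonnegative test functions `f`, then `ψ` is positive definite. For a
cutoff `χ` with `χ 0 = 1` and `f u = |∑ conj (c r) exp (2πi ⟪x r, u⟫)|² χ (δ u)`, the Fourier
transform of `f` tends to `∑ conj (c r) c s δ_{x r - x s}` as `δ → 0`. -/
theorem isPosDefFun_of_integral_mul_fourier_nonneg {ψ : Rn n → ℂ} (hcont : Continuous ψ) {C : ℝ}
    (hC : ∀ x, ‖ψ x‖ ≤ C)
    (h : ∀ f : CcInf n, (∀ x, 0 ≤ f x) → 0 ≤ ∫ v, ψ v * 𝓕 (f : Rn n → ℂ) v) :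
    IsPosDefFun ψ := by
  intro N x
  refine posSemidef_of_dotProduct_nonneg fun c => ?_
  rw [star_dotProduct_mulVec_eq_sum]
  let χ0 : ContDiffBump (0 : Rn n) := default
  let χ : Rn n → ℂ := fun u => ((χ0 u : ℝ) : ℂ)
  have hχ1 : ContDiff ℝ (⊤ : ℕ∞) χ := Complex.ofRealCLM.contDiff.comp χ0.contDiff
  have hχ2 : HasCompactSupport χ := χ0.hasCompactSupport.comp_left (g := Complex.ofReal) (by simp)
  have hχi : Integrable (𝓕 χ) := integrable_fourier_test (mkTest χ hχ1 hχ2)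
  have hχ0 : ∫ w, 𝓕 χ w = 1 := by
    have h1 := congrFun (hχ1.continuous.fourierInv_fourier_eq
      (integrable_test (mkTest χ hχ1 hχ2)) hχi) 0
    rw [Real.fourierInv_eq] at h1
    simp only [inner_zero_right, AddChar.map_zero_eq_one, one_smul] at h1
    rw [h1]
    simp [χ, χ0.one_of_mem_closedBall (Metric.mem_closedBall_self χ0.rIn_pos.le)]
  let M : Rn n → Rn n → ℂ := fun d u =>
    Complex.exp (((2 * Real.pi * inner ℝ d u : ℝ) : ℂ) * Complex.I)
  have hM1 : ∀ d, ContDiff ℝ (⊤ : ℕ∞) (M d) := fun d =>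
    ((Complex.ofRealCLM.contDiff.comp
      (contDiff_const.mul (contDiff_const.inner ℝ contDiff_id))).mul contDiff_const).cexp
  have hMM : ∀ d d' u, M (d - d') u = M d u * star (M d' u) := fun d d' u => by
    simp only [M, ← starRingEnd_apply, ← Complex.exp_conj, map_mul, Complex.conj_ofReal,
      Complex.conj_I]
    rw [← Complex.exp_add, inner_sub_left]
    congr 1
    push_cast
    ring
  have hscale : ∀ δ : ℝ, 0 < δ → HasCompactSupport fun u => χ (δ • u) := fun δ hδ =>
    hχ2.comp_homeomorph (Homeomorph.smulOfNeZero δ hδ.ne')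
  have hE2 : ∀ δ : ℝ, 0 < δ → ∀ d, HasCompactSupport fun u => M d u * χ (δ • u) := fun δ hδ d =>
    (hscale δ hδ).mul_left
  have hE1 : ∀ (δ : ℝ) d, ContDiff ℝ (⊤ : ℕ∞) fun u => M d u * χ (δ • u) := fun δ d =>
    (hM1 d).mul (hχ1.comp (contDiff_const_smul δ))
  have hval : ∀ (δ : ℝ) (hδ : 0 < δ) d, fourierPairing hcont hC (mkTest _ (hE1 δ d) (hE2 δ hδ d)) =
      ∫ w, ψ (δ • w + d) * 𝓕 χ w := fun δ hδ d => by
    change ∫ v, ψ v * 𝓕 (fun u => M d u * χ (δ • u)) v = _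
    simp only [M, fourier_modulation_mul]
    rw [← integral_mul_fourier_comp_smul (fun v => ψ (v + d)) χ hδ,
      ← integral_add_right_eq_self _ d]
    simp
  have hlim : ∀ d, Tendsto (fun k : ℕ => ∫ w, ψ ((1 / ((k : ℝ) + 1)) • w + d) * 𝓕 χ w) atTop
      (𝓝 (ψ d)) := fun d => by
    have h1 : ψ d = ∫ w, ψ d * 𝓕 χ w := by rw [integral_const_mul, hχ0, mul_one]
    rw [h1]
    refine tendsto_integral_of_dominated_convergence (fun w => C * ‖𝓕 χ w‖) (fun k => ?_)
      (hχi.norm.const_mul C) (fun k => Eventually.of_forall fun w => ?_)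
      (Eventually.of_forall fun w => ?_)
    · have := hχi.aestronglyMeasurable
      fun_prop
    · rw [norm_mul]
      exact mul_le_mul_of_nonneg_right (hC _) (norm_nonneg _)
    · refine Tendsto.mul_const _ ((hcont.tendsto d).comp ?_)
      simpa using ((tendsto_one_div_add_atTop_nhds_zero_nat (𝕜 := ℝ)).smul_const w).add_const d
  refine ge_of_tendsto (x := atTop) (f := fun k : ℕ => ∑ r, ∑ s, star (c r) *
    (∫ w, ψ ((1 / ((k : ℝ) + 1)) • w + (x r - x s)) * 𝓕 χ w) * c s) ?_
    (Eventually.of_forall fun k => ?_)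
  · exact tendsto_finsetSum _ fun r _ => tendsto_finsetSum _ fun s _ =>
      ((hlim _).const_mul _).mul_const _
  · set δ : ℝ := 1 / ((k : ℝ) + 1) with hδ
    have hδ0 : 0 < δ := by positivity
    let E : Rn n → CcInf n := fun d => mkTest _ (hE1 δ d) (hE2 δ hδ0 d)
    have hpos := h (∑ r, ∑ s, (star (c r) * c s) • E (x r - x s)) fun u => by
      let ev : CcInf n →ₗ[ℂ] ℂ :=
        { toFun := fun f => f u, map_add' := fun _ _ => rfl, map_smul' := fun _ _ => rfl }
      change 0 ≤ ev (∑ r, ∑ s, (star (c r) * c s) • E (x r - x s))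
      have hev : ∀ d, ev (E d) = M d u * χ (δ • u) := fun d => rfl
      simp only [map_sum, map_smul, hev, hMM, smul_eq_mul]
      have : ∑ r, ∑ s, star (c r) * c s * (M (x r) u * star (M (x s) u) * χ (δ • u)) =
          (∑ r, star (c r) * M (x r) u) * star (∑ r, star (c r) * M (x r) u) * χ (δ • u) := by
        rw [star_sum, Finset.sum_mul_sum, Finset.sum_mul]
        refine Finset.sum_congr rfl fun r _ => ?_
        rw [Finset.sum_mul]
        refine Finset.sum_congr rfl fun s _ => ?_
        rw [star_mul, star_star]
        ring
      rw [this]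
      exact mul_nonneg (mul_star_self_nonneg _) (Complex.zero_le_real.2 χ0.nonneg)
    have hE : ∀ d, fourierPairing hcont hC (E d) = ∫ w, ψ (δ • w + d) * 𝓕 χ w := hval δ hδ0
    change 0 ≤ fourierPairing hcont hC _ at hpos
    simp only [map_sum, map_smul, hE, smul_eq_mul] at hpos
    simpa only [mul_right_comm] using hpos

end Converse

/-! ### Diagonal exponential multipliers -/

section Diagonal

variable {m n : ℕ}

theorem multiplier_exp_smul {F : Rn n → Matrix (Fin m) (Fin m) ℂ} (hdiag : ∀ x, (F x).IsDiag)
    (t : ℝ) (f : Fin m → CcInf n) (j : Fin m) :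
    multiplier (fun y => NormedSpace.exp (t • F y)) f j =
      check fun y => Complex.exp (t * F y j j) * hat (f j) y := by
  have h : ∀ y, NormedSpace.exp (t • F y) =
      Matrix.diagonal fun j => Complex.exp (t * F y j j) := fun y => by
    rw [← (hdiag y).diagonal_diag, ← Matrix.diagonal_smul, Matrix.exp_diagonal]
    congr 1
    ext j
    simp [Pi.coe_exp, Complex.exp_eq_exp_ℂ]
  simp only [multiplier, h, Matrix.mulVec_diagonal]

theorem norm_exp_mul_le {F : Rn n → Matrix (Fin m) (Fin m) ℂ} {c : ℝ}
    (hc : ∀ x j, (F x j j).re ≤ c) {t : ℝ} (ht : 0 < t) (j : Fin m) (y : Rn n) :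
    ‖Complex.exp (t * F y j j)‖ ≤ Real.exp (t * c) := by
  rw [Complex.norm_exp, Complex.re_ofReal_mul]
  exact Real.exp_le_exp.2 (mul_le_mul_of_nonneg_left (hc y j) ht.le)

theorem continuous_exp_mul {F : Rn n → Matrix (Fin m) (Fin m) ℂ} (hF : Continuous F) (t : ℝ)
    (j : Fin m) : Continuous fun y => Complex.exp (t * F y j j) :=
  (continuous_const.mul (hF.matrix_elem j j)).cexp

/-- The multiplier operator as a linear map from test functions to `C₀`. -/
theorem exists_linearMap_multiplier {F : Rn n → Matrix (Fin m) (Fin m) ℂ} (hF : Continuous F)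
    (hdiag : ∀ x, (F x).IsDiag) {c : ℝ} (hc : ∀ x j, (F x j j).re ≤ c) {t : ℝ} (ht : 0 < t) :
    ∃ L : (Fin m → CcInf n) →ₗ[ℂ] (Fin m → C₀(Rn n, ℂ)),
      ∀ f j x, L f j x = multiplier (fun y => NormedSpace.exp (t • F y)) f j x := by
  simp_rw [multiplier_exp_smul hdiag]
  refine ⟨{ toFun := fun f j => ⟨⟨check fun y => Complex.exp (t * F y j j) * hat (f j) y,
              continuous_check_mul_hat (continuous_exp_mul hF t j) (norm_exp_mul_le hc ht j) _⟩,
              tendsto_check_mul_hat _ _⟩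
            map_add' := fun f g => ?_
            map_smul' := fun a f => ?_ }, fun f j x => rfl⟩
  · ext j x
    exact check_mul_hat_add (continuous_exp_mul hF t j) (norm_exp_mul_le hc ht j) (f j) (g j) x
  · ext j x
    exact check_mul_hat_smul _ a (f j) x

theorem extendsPosPres_of_condPosSemidef {F : Rn n → Matrix (Fin m) (Fin m) ℂ} (hF : Continuous F)
    (hdiag : ∀ x, (F x).IsDiag) {c : ℝ} (hc : ∀ x j, (F x j j).re ≤ c)
    (h : ∀ j, CondPosSemidef fun x => F x j j) {p : ℝ≥0∞} [Fact (1 ≤ p)] (hp : p ≠ ∞) {t : ℝ}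
    (ht : 0 < t) : ExtendsPosPres p fun y => NormedSpace.exp (t • F y) := by
  choose T hT hTpos using fun j => ((h j).isPosDefFun_exp ht.le).exists_extension (p := p)
    (continuous_exp_mul hF t j) (norm_exp_mul_le hc ht j) hp
  let S : LpVec p m n →L[ℂ] LpVec p m n :=
    (PiLp.continuousLinearEquiv 1 ℂ _).symm.toContinuousLinearMap ∘L
      ContinuousLinearMap.pi fun j => T j ∘L PiLp.proj 1 _ j
  have hS : ∀ u j, S u j = T j (u j) := fun u j => rfl
  refine ⟨S, fun f j => ?_, ?_⟩
  · rw [multiplier_exp_smul hdiag, hS]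
    exact hT j (f j)
  · rintro _ ⟨u, hu, rfl⟩ j
    rw [hS]
    exact hTpos j _ (hu j)

theorem condPosSemidef_of_extendsPosPres {F : Rn n → Matrix (Fin m) (Fin m) ℂ} (hF : Continuous F)
    (hdiag : ∀ x, (F x).IsDiag) {c : ℝ} (hc : ∀ x j, (F x j j).re ≤ c) {p : ℝ≥0∞} [Fact (1 ≤ p)]
    (h : ∀ t : ℝ, 0 < t → ExtendsPosPres p fun y => NormedSpace.exp (t • F y)) (j : Fin m) :
    CondPosSemidef fun x => F x j j := by
  refine condPosSemidef_of_isPosDefFun_exp fun t ht => ?_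
  obtain ⟨T, hT, hTpos⟩ := h t ht
  have hcont := continuous_exp_mul hF t j
  have hC := norm_exp_mul_le hc ht j
  have hψ : IsPosDefFun fun v : Rn n => Complex.exp (t * F ((2 * Real.pi) • v) j j) := by
    refine isPosDefFun_of_integral_mul_fourier_nonneg
      (hcont.comp (continuous_const_smul (2 * Real.pi))) (fun v => hC _) fun f hf => ?_
    have hf' : testToLp p (Pi.single j f : Fin m → CcInf n) ∈ LpVecPos p m n := fun k => by
      filter_upwards [(CcInf.memLp p ((Pi.single j f : Fin m → CcInf n) k)).coeFn_toLp] with x hx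
      change 0 ≤ (CcInf.memLp p ((Pi.single j f : Fin m → CcInf n) k)).toLp _ x
      rw [hx]
      rcases eq_or_ne k j with rfl | hk
      · simpa using hf x
      · rw [Pi.single_eq_of_ne hk]
        exact le_rfl
    set g := check fun y => Complex.exp (t * F y j j) * hat f y with hg
    have hgc : Continuous g := continuous_check_mul_hat hcont hC f
    have hae : ∀ᵐ x, 0 ≤ g x := by
      filter_upwards [hT (Pi.single j f) j, hTpos ⟨_, hf', rfl⟩ j] with x h1 h2
      rw [h1, multiplier_exp_smul hdiag, Pi.single_eq_same] at h2
      exact h2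
    have hev : 0 ≤ g 0 := by
      -- `g` is continuous, so its being nonnegative almost everywhere is the same as everywhere.
      have ho : IsOpen {x | ¬ 0 ≤ g x} := (isClosed_Ici.preimage hgc).isOpen_compl
      by_contra h0
      exact (ho.measure_pos volume ⟨0, h0⟩).ne' (ae_iff.1 hae)
    rw [hg, check_mul_hat, Real.fourierInv_eq] at hev
    simpa using hev
  have := hψ.comp_smul (2 * Real.pi)⁻¹
  simpa only [smul_inv_smul₀ (mul_pos two_pos Real.pi_pos).ne'] using this

end Diagonal

end PosPres

theorem corollary2p4 (m n : ℕ) (hm : 1 ≤ m) (hn : 1 ≤ n)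
    (F : PosPres.Rn n → Matrix (Fin m) (Fin m) ℂ) (hF : Continuous F)
    (hdiag : ∀ x, (F x).IsDiag) (c : ℝ) (hc : ∀ x j, (F x j j).re ≤ c) :
    -- the operators below are well-defined linear maps from `C₀^∞` to `C_∞`
    (∀ t : ℝ, 0 < t →
      ∃ L : (Fin m → PosPres.CcInf n) →ₗ[ℂ] (Fin m → C₀(PosPres.Rn n, ℂ)),
        ∀ f j x, L f j x = PosPres.multiplier (fun y => NormedSpace.exp (t • F y)) f j x) ∧
    List.TFAE [
      ∀ j, PosPres.CondPosSemidef fun x => F x j j,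
      ∀ t : ℝ, 0 < t → PosPres.ExtendsPosPres 1 fun y => NormedSpace.exp (t • F y),
      ∃ (p : ℝ≥0∞) (_ : Fact (1 ≤ p)), 1 < p ∧ p < ∞ ∧
        ∀ t : ℝ, 0 < t → PosPres.ExtendsPosPres p fun y => NormedSpace.exp (t • F y),
      ∀ (p : ℝ≥0∞) [Fact (1 ≤ p)], 1 < p → p < ∞ →
        ∀ t : ℝ, 0 < t → PosPres.ExtendsPosPres p fun y => NormedSpace.exp (t • F y)] := by
  refine ⟨fun t ht => PosPres.exists_linearMap_multiplier hF hdiag hc ht, ?_⟩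
  tfae_have 1 → 2 := fun h t ht =>
    PosPres.extendsPosPres_of_condPosSemidef hF hdiag hc h ENNReal.one_ne_top ht
  tfae_have 2 → 1 := fun h => PosPres.condPosSemidef_of_extendsPosPres hF hdiag hc h
  tfae_have 1 → 4 := fun h p _ _ hp t ht =>
    PosPres.extendsPosPres_of_condPosSemidef hF hdiag hc h hp.ne ht
  tfae_have 4 → 3 := fun h =>
    ⟨2, ⟨one_le_two⟩, ENNReal.one_lt_two, ENNReal.ofNat_lt_top,
      h 2 ENNReal.one_lt_two ENNReal.ofNat_lt_top⟩
  tfae_have 3 → 1 := fun ⟨_, _, _, _, h⟩ =>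
    PosPres.condPosSemidef_of_extendsPosPres hF hdiag hc h
  tfae_finish
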